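/- Let $\mathcal N$ be a countably infinite set of names, each with a sort, such that there are infinitely many names of the sort of each name. A permutation is a sort-preserving bijection of $\mathcal N$ that moves only finitely many names. A nominal set is a set with an action of the group of permutations in which each element $x$ has a finite support; $\operatorname{supp}(x)$ is its least finite support, and $N \# x$ means $N\cap\operatorname{supp}(x)=\emptyset$. For a finite $N\subseteq\mathcal N$ and an element $x$ of a nominal set, $\langle N\rangle x$ is the class of $(N,x)$, where $(N,x)$ and $(N',x')$ are equivalent iff some permutation $\pi$ has $\pi\cdot N=N'$, $\pi\cdot x=x'$ and $\pi(a)=a$ for all $a\in\operatorname{supp}(x)\setminus N$. A nominal transition system consists of nominal sets of states $P,Q$, of state predicates $\varphi$ and of actions $\alpha$; an equivariant relation $P\vdash\varphi$; an equivariant function $\operatorname{bn}$ assigning to each action $\alpha$ a finite set of names $\operatorname{bn}(\alpha)\subseteq\operatorname{supp}(\alpha)$; and an equivariant set of transitions $(P,\langle N\rangle(\alpha,P'))$, in each of which $N=\operatorname{bn}(\alpha)$. Write $P\xrightarrow{\alpha}P'$ if $(P,\langle\operatorname{bn}(\alpha)\rangle(\alpha,P'))$ is a transition. A bisimulation is a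 symmetric relation $R$ on states such that $R(P,Q)$ implies: (1) for every $\varphi$, if $P\vdash\varphi$ then $Q\vdash\varphi$; (2) for all $\alpha,P'$ with $\operatorname{bn}(\alpha)\# Q$ and $P\xrightarrow{\alpha}P'$ there is $Q'$ with $Q\xrightarrow{\alpha}Q'$ and $R(P',Q')$. States $P,Q$ are bisimilar, $P\mathrel{\dot\sim}Q$, if some bisimulation relates them. Fix a cardinal $\kappa>\aleph_0$ that is larger than the cardinality of the set of states. The nominal set of formulas is defined inductively by $$A ::= \textstyle\bigwedge_{i\in I}A_i \mid \neg A\mid \varphi\mid\langle\alpha\rangle A,$$ where in a conjunction the set $\{A_i\mid i\in I\}$ has cardinality less than $\kappa$ and has finite support (the conjunction being determined by this set), and where $\operatorname{bn}(\alpha)$ is bound in $\alpha$ and $A$ in $\langle\alpha\rangle A$, i.e. $\langle\alpha\rangle A=\langle\beta\rangle B$ iff $\langle\operatorname{bn}(\alpha)\rangle(\alpha,A)=\langle\operatorname{bn}(\beta)\rangle(\beta,B)$ as name abstractions. Validity is defined by recursion: $P\models\bigwedge_{i\in I} A_i$ iff $P\models A_i$ for all $i\in I$; $P\models\neg A$ iff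 not $P\models A$; $P\models\varphi$ iff $P\vdash\varphi$; and $P\models\langle\alpha\rangle A$ iff there are $\alpha',A'$ with $\langle\alpha'\rangle A'=\langle\alpha\rangle A$ and $\operatorname{bn}(\alpha')\#P$, and a state $P'$, such that $P\xrightarrow{\alpha'}P'$ and $P'\models A'$. States $P$ and $Q$ are logically equivalent, $P\mathrel{\dot=}Q$, if for every formula $A$: $P\models A$ iff $Q\models A$. Theorem. For all states $P,Q$ of a nominal transition system, $P\mathrel{\dot\sim}Q$ implies $P\mathrel{\dot=}Q$. -/

import Mathlib

open scoped Classical Pointwise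

universe uN uS u₁ u₂ u₃ w

namespace NominalHML

/-! ### Names, permutations, nominal sets -/

/-- The group of permutations of names: sort-preserving bijections of `𝒩` that move only
finitely many names.  `srt a` is the sort of the name `a`. -/
def FinPerm {𝒩 : Type uN} {𝒮 : Type uS} (srt : 𝒩 → 𝒮) : Subgroup (Equiv.Perm 𝒩) where
  carrier := {π | (∀ a, srt (π a) = srt a) ∧ {a | π a ≠ a}.Finite}
  one_mem' := by simp
  mul_mem' := by
    rintro π σ ⟨h1, h2⟩ ⟨h3, h4⟩
    refine ⟨fun a => by simp [h1, h3], (h2.union h4).subset ?_⟩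
    intro a ha
    by_contra hc
    simp only [Set.mem_union, Set.mem_ofPred_eq, not_or, not_not] at hc
    simp [hc.1, hc.2] at ha
  inv_mem' := by
    rintro π ⟨h1, h2⟩
    refine ⟨fun a => by rw [← h1 (π⁻¹ a)]; simp, h2.subset ?_⟩
    intro a ha hc
    exact ha (by rw [Equiv.Perm.inv_eq_iff_eq]; exact hc.symm)

/-- There are infinitely many names of the sort of each name. -/
class InfiniteSorts {𝒩 : Type uN} {𝒮 : Type uS} (srt : 𝒩 → 𝒮) : Prop where
  infinite_sort : ∀ a, {b | srt b = srt a}.Infinite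

/-- `π` leaves every member of `N` invariant. -/
def Fixes {𝒩 : Type uN} {𝒮 : Type uS} {srt : 𝒩 → 𝒮} (π : FinPerm srt) (N : Set 𝒩) : Prop :=
  ∀ a ∈ N, π • a = a

/-- `x` has a finite support. -/
def FinitelySupported {𝒩 : Type uN} {𝒮 : Type uS} (srt : 𝒩 → 𝒮) {X : Type*}
    [MulAction (FinPerm srt) X] (x : X) : Prop :=
  ∃ N : Finset 𝒩, MulAction.Supports (FinPerm srt) (N : Set 𝒩) x

/-- The support of `x`: the intersection of all finite sets of names supporting `x`.
(See `supports_supp`: it is the least finite supporting set, when there is one.) -/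
def supp {𝒩 : Type uN} {𝒮 : Type uS} (srt : 𝒩 → 𝒮) {X : Type*}
    [MulAction (FinPerm srt) X] (x : X) : Set 𝒩 :=
  {a | ∀ N : Finset 𝒩, MulAction.Supports (FinPerm srt) (N : Set 𝒩) x → a ∈ N}

/-- `N # x`: every name of `N` is fresh for `x`. -/
def FreshFor {𝒩 : Type uN} {𝒮 : Type uS} (srt : 𝒩 → 𝒮) {X : Type*}
    [MulAction (FinPerm srt) X] (N : Finset 𝒩) (x : X) : Prop :=
  ∀ a ∈ N, a ∉ supp srt x

/-- A nominal set: a type with a permutation action all of whose elements are finitely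
supported. -/
class NominalSet {𝒩 : Type uN} {𝒮 : Type uS} (srt : 𝒩 → 𝒮) (X : Type*)
    extends MulAction (FinPerm srt) X where
  finitelySupported : ∀ x : X, FinitelySupported srt x

section Basics

variable {𝒩 : Type uN} {𝒮 : Type uS} {srt : 𝒩 → 𝒮} {X : Type*} [MulAction (FinPerm srt) X]

theorem smul_name (π : FinPerm srt) (a : 𝒩) : π • a = (π : Equiv.Perm 𝒩) a := rfl

theorem supports_iff {N : Set 𝒩} {x : X} :
    MulAction.Supports (FinPerm srt) N x ↔ ∀ π : FinPerm srt, Fixes π N → π • x = x :=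
  Iff.rfl

theorem Fixes.conj {π : FinPerm srt} {N : Set 𝒩} (σ : FinPerm srt) (h : Fixes σ (π • N)) :
    Fixes (π⁻¹ * σ * π) N := by
  intro a ha
  rw [mul_smul, mul_smul, h _ (Set.smul_mem_smul_set ha), inv_smul_smul]

theorem Fixes.conj' {π : FinPerm srt} {N : Set 𝒩} (σ : FinPerm srt) (h : Fixes π N) :
    Fixes (σ * π * σ⁻¹) (σ • N) := by
  rintro _ ⟨a, ha, rfl⟩
  simp only [mul_smul, inv_smul_smul, h a ha]

theorem supports_smul {N : Set 𝒩} {x : X} (π : FinPerm srt)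
    (h : MulAction.Supports (FinPerm srt) N x) :
    MulAction.Supports (FinPerm srt) (π • N) (π • x) := by
  rw [supports_iff] at *
  intro σ hσ
  have := h _ (Fixes.conj σ hσ)
  rw [mul_smul, mul_smul, inv_smul_eq_iff] at this
  exact this

theorem FinitelySupported.smul {x : X} (h : FinitelySupported srt x) (π : FinPerm srt) :
    FinitelySupported srt (π • x) := by
  obtain ⟨N, hN⟩ := h
  refine ⟨π • N, ?_⟩
  rw [Finset.coe_smul_finset]
  exact supports_smul π hN

theorem smul_mem_supp {a : 𝒩} {x : X} (π : FinPerm srt) (h : a ∈ supp srt x) :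
    π • a ∈ supp srt (π • x) := by
  intro N hN
  have h2 := supports_smul π⁻¹ hN
  rw [inv_smul_smul, ← Finset.coe_smul_finset] at h2
  have := h _ h2
  rwa [Finset.mem_inv_smul_finset_iff] at this

theorem supp_smul (π : FinPerm srt) (x : X) : supp srt (π • x) = π • supp srt x := by
  ext a
  rw [Set.mem_smul_set_iff_inv_smul_mem]
  constructor
  · intro h
    simpa using smul_mem_supp π⁻¹ h
  · intro h
    simpa using smul_mem_supp π h

theorem exists_fresh [InfiniteSorts srt] (A B : Finset 𝒩) :
    ∃ τ : FinPerm srt, (∀ a ∈ A, τ • a ∉ B) ∧ ∀ b ∈ B, b ∉ A → τ • b = b := by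
  induction A using Finset.induction_on with
  | empty => exact ⟨1, by simp, by simp⟩
  | insert a A _ ih =>
    obtain ⟨τ, h1, h2⟩ := ih
    obtain ⟨b, hb, hb'⟩ := (InfiniteSorts.infinite_sort (srt := srt) a).exists_notMem_finset
      (insert a A ∪ B ∪ τ⁻¹ • B)
    have hb : srt b = srt a := hb
    simp only [Finset.mem_union, not_or, Finset.mem_insert, Finset.mem_inv_smul_finset_iff] at hb'
    let s : FinPerm srt := ⟨Equiv.swap a b, by
      refine ⟨fun c => ?_, (Set.toFinite {a, b}).subset ?_⟩
      · rcases eq_or_ne c a with rfl | h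
        · simp [hb]
        rcases eq_or_ne c b with rfl | h'
        · simp [hb]
        rw [Equiv.swap_apply_of_ne_of_ne h h']
      · intro c hc
        by_contra hh
        simp only [Set.mem_insert_iff, Set.mem_singleton_iff, not_or] at hh
        exact hc (Equiv.swap_apply_of_ne_of_ne hh.1 hh.2)⟩
    have hs : ∀ c, s • c = Equiv.swap a b c := fun c => rfl
    refine ⟨τ * s, ?_, ?_⟩
    · intro c hc
      rw [mul_smul, hs]
      rcases eq_or_ne c a with rfl | h
      · rw [Equiv.swap_apply_left]; exact hb'.2
      have hcA : c ∈ A := by simpa [h] using hc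
      rw [Equiv.swap_apply_of_ne_of_ne h (by rintro rfl; exact hb'.1.1.2 hcA)]
      exact h1 c hcA
    · intro c hc hcA
      simp only [Finset.mem_insert, not_or] at hcA
      rw [mul_smul, hs, Equiv.swap_apply_of_ne_of_ne hcA.1 (by rintro rfl; exact hb'.1.2 hc)]
      exact h2 c hc hcA.2

theorem mem_of_fixes_inter [InfiniteSorts srt] (H : Subgroup (FinPerm srt)) (M N : Finset 𝒩)
    (hM : ∀ π, Fixes π (M : Set 𝒩) → π ∈ H) (hN : ∀ π, Fixes π (N : Set 𝒩) → π ∈ H)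
    (π : FinPerm srt) (hπ : Fixes π ((M ∩ N : Finset 𝒩) : Set 𝒩)) : π ∈ H := by
  obtain ⟨τ, h1, h2⟩ := exists_fresh (srt := srt) (N \ M) (M ∪ N ∪ π.2.2.toFinset)
  have hτ : τ ∈ H := hM τ fun a ha => h2 a (by simp_all) (by simp_all)
  have h3 : τ⁻¹ * π * τ ∈ H := by
    refine hN _ fun a ha => ?_
    rw [mul_smul, mul_smul, inv_smul_eq_iff]
    by_cases haM : a ∈ M
    · rw [h2 a (by simp [haM]) (by simp [haM])]
      exact hπ a (by simpa using ⟨haM, ha⟩)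
    · have := h1 a (by simpa [haM] using ha)
      simp only [Finset.mem_union, Set.Finite.mem_toFinset, Set.mem_ofPred_eq, not_or,
        not_not] at this
      exact this.2
  have := H.mul_mem (H.mul_mem hτ h3) (H.inv_mem hτ)
  simpa [mul_assoc] using this

theorem supports_inter [InfiniteSorts srt] {M N : Finset 𝒩} {x : X}
    (hM : MulAction.Supports (FinPerm srt) (M : Set 𝒩) x)
    (hN : MulAction.Supports (FinPerm srt) (N : Set 𝒩) x) :
    MulAction.Supports (FinPerm srt) ((M ∩ N : Finset 𝒩) : Set 𝒩) x :=
  fun π hπ => mem_of_fixes_inter (MulAction.stabilizer _ x) M N hM hN π fun _ ha => hπ ha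

/-- If `x` is finitely supported, then `supp x` is finite and supports `x`. -/
theorem supports_supp [InfiniteSorts srt] {x : X} (h : FinitelySupported srt x) :
    (supp srt x).Finite ∧ MulAction.Supports (FinPerm srt) (supp srt x) x := by
  obtain ⟨N, hN⟩ : ∃ N : Finset 𝒩, Minimal
      (fun N : Finset 𝒩 => MulAction.Supports (FinPerm srt) (N : Set 𝒩) x) N :=
    exists_minimal_of_wellFoundedLT _ h
  have : supp srt x = N := by
    ext a
    refine ⟨fun ha => ha N hN.1, fun ha M hM => ?_⟩
    exact (Finset.mem_inter.1 (hN.2 (supports_inter hM hN.1) Finset.inter_subset_right ha)).1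
  rw [this]
  exact ⟨N.finite_toSet, hN.1⟩

end Basics

/-! ### Generalised name abstraction -/

section Abstraction

variable {𝒩 : Type uN} {𝒮 : Type uS} (srt : 𝒩 → 𝒮) (X : Type*) [MulAction (FinPerm srt) X]

/-- Nominal alpha-equivalence of pairs `(N, x)`. -/
def absSetoid : Setoid (Finset 𝒩 × X) where
  r p q := ∃ π : FinPerm srt, π • p = q ∧ ∀ a ∈ supp srt p.2 \ (p.1 : Set 𝒩), π • a = a
  iseqv := by
    refine ⟨fun p => ⟨1, by simp⟩, ?_, ?_⟩
    · rintro p _ ⟨π, rfl, h⟩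
      refine ⟨π⁻¹, by simp, fun a ha => ?_⟩
      rw [Prod.smul_snd, supp_smul, Prod.smul_fst, Finset.coe_smul_finset,
        ← Set.smul_set_sdiff] at ha
      obtain ⟨b, hb, rfl⟩ := ha
      rw [inv_smul_eq_iff]
      exact (congrArg _ (h b hb)).symm
    · rintro p _ _ ⟨π, rfl, h⟩ ⟨σ, rfl, h'⟩
      refine ⟨σ * π, mul_smul _ _ _, fun a ha => ?_⟩
      have h3 : π • a ∈ supp srt (π • p).2 \ ((π • p).1 : Set 𝒩) := by
        rw [Prod.smul_snd, supp_smul, Prod.smul_fst, Finset.coe_smul_finset,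
          ← Set.smul_set_sdiff]
        exact Set.smul_mem_smul_set ha
      rw [mul_smul, h' _ h3, h a ha]

/-- The set of abstractions `⟨N⟩x`, with `N` a finite set of names and `x : X`. -/
def Abs : Type _ := Quotient (absSetoid srt X)

variable {X}

/-- The abstraction `⟨N⟩x`. -/
def Abs.mk (N : Finset 𝒩) (x : X) : Abs srt X := Quotient.mk (absSetoid srt X) (N, x)

noncomputable instance : MulAction (FinPerm srt) (Abs srt X) where
  smul σ := Quotient.map (fun p => σ • p) (by
    rintro p _ ⟨π, rfl, h⟩
    refine ⟨σ * π * σ⁻¹, by simp [mul_smul], fun a ha => ?_⟩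
    rw [Prod.smul_snd, supp_smul, Prod.smul_fst, Finset.coe_smul_finset,
      ← Set.smul_set_sdiff] at ha
    exact Fixes.conj' σ h a ha)
  one_smul := by
    rintro ⟨p⟩
    exact congrArg (Quotient.mk _) (one_smul _ p)
  mul_smul := by
    rintro σ τ ⟨p⟩
    exact congrArg (Quotient.mk _) (mul_smul σ τ p)

end Abstraction

/-! ### Nominal transition systems and bisimilarity -/

/-- A nominal transition system. -/
structure NTS {𝒩 : Type uN} {𝒮 : Type uS} (srt : 𝒩 → 𝒮)
    (State : Type u₁) (Pred : Type u₂) (Act : Type u₃)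
    [NominalSet srt State] [NominalSet srt Pred] [NominalSet srt Act] where
  /-- `entails P φ`: the state predicate `φ` holds in the state `P`. -/
  entails : State → Pred → Prop
  entails_equivariant : ∀ (π : FinPerm srt) (P : State) (φ : Pred),
    entails P φ → entails (π • P) (π • φ)
  /-- The binding names of an action. -/
  bn : Act → Finset 𝒩
  bn_equivariant : ∀ (π : FinPerm srt) (α : Act), bn (π • α) = π • bn α
  bn_subset_supp : ∀ α : Act, (bn α : Set 𝒩) ⊆ supp srt α
  /-- The transition relation, a set of pairs of a state and a residual. -/
  trans : Set (State × Abs srt (Act × State))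
  trans_equivariant : ∀ (π : FinPerm srt) (t : State × Abs srt (Act × State)),
    t ∈ trans → π • t ∈ trans
  trans_bn : ∀ (P : State) (N : Finset 𝒩) (α : Act) (Q : State),
    (P, Abs.mk srt N (α, Q)) ∈ trans → bn α = N

section Main

variable {𝒩 : Type uN} {𝒮 : Type uS} {srt : 𝒩 → 𝒮}
  {State : Type u₁} {Pred : Type u₂} {Act : Type u₃}
  [NominalSet srt State] [NominalSet srt Pred] [NominalSet srt Act]

/-- `T.Step P α P'` is the transition from `P` to `P'` with action `α`. -/
def NTS.Step (T : NTS srt State Pred Act) (P : State) (α : Act) (P' : State) : Prop :=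
  (P, Abs.mk srt (T.bn α) (α, P')) ∈ T.trans

/-- Bisimulations. -/
structure NTS.IsBisimulation (T : NTS srt State Pred Act) (R : State → State → Prop) : Prop where
  symm : ∀ P Q, R P Q → R Q P
  static_implication : ∀ P Q, R P Q → ∀ φ, T.entails P φ → T.entails Q φ
  simulation : ∀ P Q, R P Q → ∀ α P', FreshFor srt (T.bn α) Q → T.Step P α P' →
    ∃ Q', T.Step Q α Q' ∧ R P' Q'

/-- Bisimilarity. -/
def NTS.Bisimilar (T : NTS srt State Pred Act) (P Q : State) : Prop :=
  ∃ R, T.IsBisimulation R ∧ R P Q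

/-! ### Raw formulas and their alpha-equivalence -/

/-- Raw formulas: formula trees in which alpha-equivalent formulas are not identified.
A conjunction is a family of fewer than `κ` raw formulas; the index sets are taken to be the
subsets of size less than `κ` of a fixed type of size `κ`. -/
inductive Raw (Pred : Type u₂) (Act : Type u₃) (κ : Cardinal.{w}) : Type (max u₂ u₃ w)
  | conj (I : Set κ.out) (hI : Cardinal.mk I < κ) (f : I → Raw Pred Act κ) : Raw Pred Act κ
  | neg (R : Raw Pred Act κ) : Raw Pred Act κ
  | pred (φ : Pred) : Raw Pred Act κ
  | act (α : Act) (R : Raw Pred Act κ) : Raw Pred Act κ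

variable {κ : Cardinal.{w}}

/-- Name permutation distributes over all raw constructors. -/
def Raw.perm (π : FinPerm srt) : Raw Pred Act κ → Raw Pred Act κ
  | .conj I hI f => .conj I hI fun i => (f i).perm π
  | .neg R => .neg (R.perm π)
  | .pred φ => .pred (π • φ)
  | .act α R => .act (π • α) (R.perm π)

instance : MulAction (FinPerm srt) (Raw Pred Act κ) where
  smul := Raw.perm
  one_smul R := by
    change Raw.perm 1 R = R
    induction R with
    | conj I hI f ih => simp only [Raw.perm, ih]
    | neg R ih => simp only [Raw.perm, ih]
    | pred φ => simp only [Raw.perm, one_smul]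
    | act α R ih => simp only [Raw.perm, ih, one_smul]
  mul_smul π σ R := by
    change Raw.perm (π * σ) R = Raw.perm π (Raw.perm σ R)
    induction R with
    | conj I hI f ih => simp only [Raw.perm, ih]
    | neg R ih => simp only [Raw.perm, ih]
    | pred φ => simp only [Raw.perm, mul_smul]
    | act α R ih => simp only [Raw.perm, ih, mul_smul]

theorem Raw.smul_conj (π : FinPerm srt) (I : Set κ.out) (hI) (f : I → Raw Pred Act κ) :
    π • Raw.conj I hI f = .conj I hI fun i => π • f i := rfl
theorem Raw.smul_neg (π : FinPerm srt) (R : Raw Pred Act κ) :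
    π • Raw.neg R = .neg (π • R) := rfl
theorem Raw.smul_pred (π : FinPerm srt) (φ : Pred) :
    π • (Raw.pred φ : Raw Pred Act κ) = .pred (π • φ) := rfl
theorem Raw.smul_act (π : FinPerm srt) (α : Act) (R : Raw Pred Act κ) :
    π • Raw.act α R = .act (π • α) (π • R) := rfl

/-- Alpha-equivalence of raw formulas.  Conjunctions are compared as sets of classes (`u` and `v`
choose equivalent conjuncts); `act α R` binds the names `bn α` in `α` and `R`, so `act α R` and
`act β S` are equivalent if some `π` maps `(α, R)` to `(β, S)` up to equivalence and fixes
`N \ bn α`, where `N` is a finite support of `α` and of the class of `R`.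
(See `Formula.dia_eq_dia` for the resulting equality of formulas.) -/
inductive Raw.Alpha (T : NTS srt State Pred Act) : Raw Pred Act κ → Raw Pred Act κ → Prop
  | conj {I J : Set κ.out} {hI hJ} {f : I → Raw Pred Act κ} {g : J → Raw Pred Act κ} (u : I → J) (v : J → I)
      (hu : ∀ i, Alpha T (f i) (g (u i))) (hv : ∀ j, Alpha T (f (v j)) (g j)) :
      Alpha T (.conj I hI f) (.conj J hJ g)
  | neg {R S} (h : Alpha T R S) : Alpha T (.neg R) (.neg S)
  | pred (φ) : Alpha T (.pred φ) (.pred φ)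
  | act {α R β S} (N : Finset 𝒩) (π : FinPerm srt)
      (hα : MulAction.Supports (FinPerm srt) (N : Set 𝒩) α)
      (hR : ∀ σ : FinPerm srt, Fixes σ (N : Set 𝒩) → Alpha T (σ • R) R)
      (hπ : Fixes π ((N : Set 𝒩) \ T.bn α))
      (hβ : π • α = β) (hS : Alpha T (π • R) S) :
      Alpha T (.act α R) (.act β S)

/-- Well-formed raw formulas: every conjunction in it is over a set of alpha-equivalence classes
that has finite support. -/
def Raw.WF (T : NTS srt State Pred Act) : Raw Pred Act κ → Prop
  | .conj _ _ f => (∀ i, (f i).WF T) ∧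
      ∃ N : Finset 𝒩, ∀ π : FinPerm srt, Fixes π (N : Set 𝒩) →
        (∀ i, ∃ j, Raw.Alpha T (π • f i) (f j)) ∧ ∀ j, ∃ i, Raw.Alpha T (π • f i) (f j)
  | .neg R => R.WF T
  | .pred _ => True
  | .act _ R => R.WF T

theorem Raw.WF.neg {T : NTS srt State Pred Act} {R : Raw Pred Act κ} (h : R.WF T) :
    (Raw.neg R).WF T := h
theorem Raw.WF.pred {T : NTS srt State Pred Act} (φ : Pred) :
    (Raw.pred φ : Raw Pred Act κ).WF T := trivial
theorem Raw.WF.act {T : NTS srt State Pred Act} {R : Raw Pred Act κ} (h : R.WF T) (α : Act) :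
    (Raw.act α R).WF T := h

theorem Raw.Alpha.smul {T : NTS srt State Pred Act} {R S : Raw Pred Act κ}
    (h : Raw.Alpha T R S) (σ : FinPerm srt) : Raw.Alpha T (σ • R) (σ • S) := by
  induction h generalizing σ with
  | conj u v _ _ hu hv => exact .conj u v (fun i => hu i σ) (fun j => hv j σ)
  | neg _ ih => exact .neg (ih σ)
  | pred φ => exact .pred _
  | @act α R β S N π hα hR hπ hβ hS ihR ihS =>
    refine .act (σ • N) (σ * π * σ⁻¹) ?_ ?_ ?_ ?_ ?_
    · rw [Finset.coe_smul_finset]; exact supports_smul σ hα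
    · intro τ hτ
      rw [Finset.coe_smul_finset] at hτ
      have := ihR _ (Fixes.conj τ hτ) σ
      change Raw.Alpha T (σ • (σ⁻¹ * τ * σ) • R) (σ • R) at this
      rwa [← mul_smul, mul_assoc σ⁻¹, mul_inv_cancel_left, mul_smul] at this
    · rw [T.bn_equivariant, Finset.coe_smul_finset, Finset.coe_smul_finset,
        ← Set.smul_set_sdiff]
      exact Fixes.conj' σ hπ
    · simp [mul_smul, hβ]
    · have := ihS σ
      change Raw.Alpha T (σ • π • R) (σ • S) at this
      change Raw.Alpha T ((σ * π * σ⁻¹) • σ • R) (σ • S)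
      simpa [mul_smul] using this

theorem Raw.WF.smul {T : NTS srt State Pred Act} {R : Raw Pred Act κ}
    (h : R.WF T) (σ : FinPerm srt) : (σ • R).WF T := by
  induction R with
  | conj I hI f ih =>
    simp only [Raw.WF] at h
    obtain ⟨h1, N, hN⟩ := h
    refine ⟨fun i => ih i (h1 i), σ • N, fun π hπ => ?_⟩
    rw [Finset.coe_smul_finset] at hπ
    have key : ∀ i j, Raw.Alpha T ((σ⁻¹ * π * σ) • f i) (f j) →
        Raw.Alpha T (π • σ • f i) (σ • f j) := fun i j h => by
      have := h.smul σ
      rwa [← mul_smul, mul_assoc σ⁻¹, mul_inv_cancel_left, mul_smul] at this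
    obtain ⟨h2, h3⟩ := hN _ (Fixes.conj π hπ)
    exact ⟨fun i => (h2 i).imp fun j => key i j, fun j => (h3 j).imp fun i => key i j⟩
  | neg R ih => exact ih h
  | pred φ => trivial
  | act α R ih => exact ih h

theorem Raw.WF.refl_and_support {T : NTS srt State Pred Act} {R : Raw Pred Act κ}
    (h : R.WF T) : Raw.Alpha T R R ∧ ∃ N : Finset 𝒩, ∀ σ : FinPerm srt, Fixes σ (N : Set 𝒩) →
      Raw.Alpha T (σ • R) R := by
  induction R with
  | conj I hI f ih =>
    obtain ⟨h1, N, hN⟩ := h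
    refine ⟨.conj id id (fun i => (ih i (h1 i)).1) (fun i => (ih i (h1 i)).1), N, fun σ hσ => ?_⟩
    obtain ⟨h2, h3⟩ := hN σ hσ
    choose u hu using h2
    choose v hv using h3
    exact .conj u v hu hv
  | neg R ih =>
    obtain ⟨h1, N, hN⟩ := ih h
    exact ⟨.neg h1, N, fun σ hσ => .neg (hN σ hσ)⟩
  | pred φ =>
    obtain ⟨N, hN⟩ := NominalSet.finitelySupported (srt := srt) φ
    refine ⟨.pred _, N, fun σ hσ => ?_⟩
    rw [Raw.smul_pred, supports_iff.1 hN σ hσ]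
    exact .pred _
  | act α R ih =>
    obtain ⟨h1, N, hN⟩ := ih h
    obtain ⟨M, hM⟩ := NominalSet.finitelySupported (srt := srt) α
    have key : ∀ σ : FinPerm srt, Fixes σ ((M ∪ N : Finset 𝒩) : Set 𝒩) →
        σ • α = α ∧ Raw.Alpha T (σ • R) R := fun σ hσ =>
      ⟨hM σ fun a ha => hσ a (by simp [Finset.mem_coe.1 ha]),
        hN σ fun a ha => hσ a (by simp [Finset.mem_coe.1 ha])⟩
    have key2 : ∀ σ : FinPerm srt, Fixes σ ((M ∪ N : Finset 𝒩) : Set 𝒩) →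
        Raw.Alpha T (.act α R) (.act (σ • α) (σ • R)) := fun σ hσ => by
      refine .act (M ∪ N) σ (fun σ hσ => (key σ fun a ha => hσ ha).1)
        (fun σ hσ => (key σ hσ).2) (fun a ha => hσ a ha.1) rfl (h1.smul σ)
    have hrefl : Raw.Alpha T (.act α R) (.act α R) := by
      have := key2 1 (fun a _ => one_smul _ a)
      rwa [one_smul, one_smul] at this
    refine ⟨hrefl, M ∪ N, fun σ hσ => ?_⟩
    have h2 : Fixes σ⁻¹ ((M ∪ N : Finset 𝒩) : Set 𝒩) := fun a ha => by
      rw [inv_smul_eq_iff, hσ a ha]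
    have := (key2 _ h2).smul σ
    rwa [Raw.smul_act, Raw.smul_act, smul_inv_smul, smul_inv_smul] at this

theorem Raw.Alpha.symm_eucl [InfiniteSorts srt] {T : NTS srt State Pred Act}
    (R : Raw Pred Act κ) :
    (∀ (π : FinPerm srt) (S : Raw Pred Act κ),
      Raw.Alpha T (π • R) S → Raw.Alpha T S (π • R)) ∧
    ∀ (π : FinPerm srt) (S S' : Raw Pred Act κ),
      Raw.Alpha T (π • R) S → Raw.Alpha T (π • R) S' → Raw.Alpha T S S' := by
  induction R with
  | conj I hI f ih =>
    refine ⟨fun π S h => ?_, fun π S S' h h' => ?_⟩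
    · rw [Raw.smul_conj] at *
      cases h with
      | conj u v hu hv =>
        exact .conj v u (fun j => (ih _).1 _ _ (hv j)) (fun i => (ih _).1 _ _ (hu i))
    · rw [Raw.smul_conj] at *
      cases h with
      | conj u v hu hv =>
        cases h' with
        | conj u' v' hu' hv' =>
          exact .conj (u' ∘ v) (u ∘ v')
            (fun i => (ih _).2 _ _ _ (hv i) (hu' _)) (fun j => (ih _).2 _ _ _ (hu _) (hv' j))
  | neg R ih =>
    refine ⟨fun π S h => ?_, fun π S S' h h' => ?_⟩
    · rw [Raw.smul_neg] at *
      cases h with | neg h => exact .neg (ih.1 _ _ h)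
    · rw [Raw.smul_neg] at *
      cases h with | neg h => cases h' with | neg h' => exact .neg (ih.2 _ _ _ h h')
  | pred φ =>
    refine ⟨fun π S h => ?_, fun π S S' h h' => ?_⟩
    · rw [Raw.smul_pred] at *
      cases h; exact .pred _
    · rw [Raw.smul_pred] at *
      cases h; exact h'
  | act α R ih =>
    obtain ⟨sy, eu⟩ := ih
    have transport : ∀ (ρ π : FinPerm srt) (S : Raw Pred Act κ) (N : Finset 𝒩),
        Raw.Alpha T (π • ρ • R) S →
        (∀ σ : FinPerm srt, Fixes σ (N : Set 𝒩) → Raw.Alpha T (σ • ρ • R) (ρ • R)) →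
        ∀ σ : FinPerm srt, Fixes σ ((π • N : Finset 𝒩) : Set 𝒩) → Raw.Alpha T (σ • S) S := by
      intro ρ π S N h hN σ hσ
      rw [Finset.coe_smul_finset] at hσ
      have h1 := h.smul σ
      have h2 := (hN _ (Fixes.conj σ hσ)).smul π
      rw [smul_smul, ← mul_assoc, mul_inv_cancel_left, mul_smul] at h2
      simp only [smul_smul] at h h1 h2
      have h3 := eu _ _ _ (sy _ _ h2) h
      exact eu _ _ _ h1 h3
    refine ⟨fun ρ S h => ?_, fun ρ S S' h h' => ?_⟩
    · rw [Raw.smul_act] at *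
      cases h with
      | act N π hα hR hπ hβ hS =>
        refine .act (π • N) π⁻¹ ?_ (transport ρ π _ N hS hR) ?_ ?_ ?_
        · rw [Finset.coe_smul_finset, ← hβ]; exact supports_smul π hα
        · rw [← hβ, T.bn_equivariant, Finset.coe_smul_finset, Finset.coe_smul_finset,
            ← Set.smul_set_sdiff]
          rintro _ ⟨a, ha, rfl⟩
          rw [inv_smul_eq_iff]
          exact (congrArg _ (hπ a ha)).symm
        · rw [← hβ, inv_smul_smul]
        · rw [smul_smul] at hS
          have := (sy _ _ hS).smul π⁻¹
          rwa [mul_smul, inv_smul_smul] at this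
    · rw [Raw.smul_act] at *
      cases h with
      | act N π hα hR hπ hβ hS =>
        cases h' with
        | act M τ hα' hR' hτ hγ hS' =>
          let H : Subgroup (FinPerm srt) :=
            { carrier := {σ | Raw.Alpha T (σ • ρ • R) (ρ • R)}
              one_mem' := hR 1 fun a _ => one_smul _ a
              mul_mem' := by
                intro σ σ' h h'
                have h1 := Raw.Alpha.smul h' σ
                have h2 : Raw.Alpha T (σ • ρ • R) (ρ • R) := h
                change Raw.Alpha T _ _
                simp only [smul_smul] at h1 h2 ⊢
                rw [← mul_assoc] at h1
                exact eu _ _ _ (sy _ _ h1) h2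
              inv_mem' := by
                intro σ h
                have h1 := Raw.Alpha.smul h σ⁻¹
                rw [inv_smul_smul] at h1
                exact sy _ _ h1 }
          have hNM : ∀ σ : FinPerm srt, Fixes σ ((N ∩ M : Finset 𝒩) : Set 𝒩) →
              Raw.Alpha T (σ • ρ • R) (ρ • R) := fun σ hσ =>
            mem_of_fixes_inter H N M hR hR' σ hσ
          refine .act (π • (N ∩ M)) (τ * π⁻¹) ?_ (transport ρ π _ (N ∩ M) hS hNM) ?_ ?_ ?_
          · rw [Finset.coe_smul_finset, ← hβ]; exact supports_smul π (supports_inter hα hα')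
          · rw [← hβ, T.bn_equivariant, Finset.coe_smul_finset, Finset.coe_smul_finset,
              ← Set.smul_set_sdiff]
            rintro _ ⟨a, ⟨ha, hb⟩, rfl⟩
            have ha' := Finset.mem_inter.1 (Finset.mem_coe.1 ha)
            change (τ * π⁻¹) • π • a = π • a
            rw [mul_smul, inv_smul_smul, hτ a ⟨ha'.2, hb⟩, hπ a ⟨ha'.1, hb⟩]
          · rw [← hβ, mul_smul, inv_smul_smul, hγ]
          · have h1 := hS.smul (τ * π⁻¹)
            rw [mul_smul, inv_smul_smul] at h1
            rw [smul_smul] at h1 hS'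
            exact eu _ _ _ h1 hS'

theorem Raw.Alpha.symm [InfiniteSorts srt] {T : NTS srt State Pred Act}
    {R S : Raw Pred Act κ} (h : Raw.Alpha T R S) : Raw.Alpha T S R := by
  have := (Raw.Alpha.symm_eucl (T := T) R).1 1 S
  rw [one_smul] at this
  exact this h

theorem Raw.Alpha.trans [InfiniteSorts srt] {T : NTS srt State Pred Act}
    {R S S' : Raw Pred Act κ} (h : Raw.Alpha T R S) (h' : Raw.Alpha T S S') :
    Raw.Alpha T R S' := by
  have := (Raw.Alpha.symm_eucl (T := T) S).2 1 R S'
  rw [one_smul] at this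
  exact this h.symm h'

/-! ### Formulas -/

variable [InfiniteSorts srt]

/-- Alpha-equivalence on well-formed raw formulas. -/
def formulaSetoid (T : NTS srt State Pred Act) (κ : Cardinal.{w}) :
    Setoid {R : Raw Pred Act κ // R.WF T} where
  r R S := Raw.Alpha T R.1 S.1
  iseqv := ⟨fun R => R.2.refl_and_support.1, Raw.Alpha.symm, Raw.Alpha.trans⟩

/-- The nominal set of formulas: well-formed raw formulas up to alpha-equivalence. -/
def Formula (T : NTS srt State Pred Act) (κ : Cardinal.{w}) : Type (max u₂ u₃ w) :=
  Quotient (formulaSetoid T κ)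

namespace Formula

variable {T : NTS srt State Pred Act}

/-- The formula given by a well-formed raw formula. -/
def mk (R : Raw Pred Act κ) (h : R.WF T) : Formula T κ := Quotient.mk (formulaSetoid T κ) ⟨R, h⟩

theorem mk_eq_mk {R S : Raw Pred Act κ} {h : R.WF T} {h' : S.WF T} :
    mk R h = mk S h' ↔ Raw.Alpha T R S :=
  Quotient.eq (r := formulaSetoid T κ)

theorem exists_mk (A : Formula T κ) : ∃ R h, mk R h = A := by
  obtain ⟨⟨R, h⟩⟩ := A
  exact ⟨R, h, rfl⟩

instance : MulAction (FinPerm srt) (Formula T κ) where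
  smul π := Quotient.map (fun R => ⟨π • R.1, R.2.smul π⟩) fun _ _ h => Raw.Alpha.smul h π
  one_smul := by
    rintro ⟨R⟩
    exact congrArg (Quotient.mk _) (Subtype.ext (one_smul _ R.1))
  mul_smul := by
    rintro σ τ ⟨R⟩
    exact congrArg (Quotient.mk _) (Subtype.ext (mul_smul σ τ R.1))

theorem smul_mk (π : FinPerm srt) (R : Raw Pred Act κ) (h : R.WF T) :
    π • mk R h = mk (π • R) (h.smul π) := rfl

instance : NominalSet srt (Formula T κ) where
  finitelySupported A := by
    obtain ⟨R, h, rfl⟩ := exists_mk A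
    obtain ⟨N, hN⟩ := h.refl_and_support.2
    exact ⟨N, fun π hπ => mk_eq_mk.2 (hN π fun a ha => hπ ha)⟩

theorem exists_index (S : Set (Formula T κ))
    (hS : Cardinal.mk S < Cardinal.lift.{max u₂ u₃} κ) :
    ∃ (I : Set κ.out) (_ : Cardinal.mk I < κ) (f : I → Raw Pred Act κ) (h : ∀ i, (f i).WF T),
      Set.range (fun i => mk (f i) (h i)) = S := by
  have h1 : Cardinal.lift.{w} (Cardinal.mk S) ≤
      Cardinal.lift.{max u₂ u₃ w} (Cardinal.mk κ.out) := by
    rw [Cardinal.mk_out, Cardinal.lift_id'.{w, max u₂ u₃ w}, Cardinal.lift_umax.{w, max u₂ u₃}]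
    exact hS.le
  obtain ⟨e⟩ := Cardinal.lift_mk_le'.1 h1
  have h2 := Cardinal.mk_range_eq_of_injective e.injective
  rw [Cardinal.lift_id'.{w, max u₂ u₃ w}] at h2
  have h3 : Cardinal.mk (Set.range e) < κ := by
    rw [← Cardinal.lift_lt.{w, max u₂ u₃}, ← Cardinal.lift_umax.{w, max u₂ u₃}, h2,
      Cardinal.lift_umax.{w, max u₂ u₃}]
    exact hS
  choose f hf hmk using fun A : Formula T κ => exists_mk A
  let e' := Equiv.ofInjective e e.injective
  refine ⟨Set.range e, h3, fun i => f (e'.symm i), fun i => hf _, ?_⟩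
  ext A
  simp only [hmk, Set.mem_range]
  exact ⟨fun ⟨i, hi⟩ => hi ▸ (e'.symm i).2, fun hA => ⟨e' ⟨A, hA⟩, by simp⟩⟩

theorem wf_conj {I : Set κ.out} {hI : Cardinal.mk I < κ} {f : I → Raw Pred Act κ}
    (h : ∀ i, (f i).WF T) :
    (Raw.conj I hI f).WF T ↔ FinitelySupported srt (Set.range fun i => mk (f i) (h i)) := by
  have key : ∀ π : FinPerm srt,
      π • (Set.range fun i => mk (f i) (h i)) = (Set.range fun i => mk (f i) (h i)) ↔
      (∀ i, ∃ j, Raw.Alpha T (π • f i) (f j)) ∧ ∀ j, ∃ i, Raw.Alpha T (π • f i) (f j) := by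
    intro π
    rw [Set.Subset.antisymm_iff]
    refine and_congr ⟨fun h1 i => ?_, ?_⟩ ⟨fun h1 j => ?_, ?_⟩
    · obtain ⟨j, hj⟩ := h1 (Set.smul_mem_smul_set ⟨i, rfl⟩)
      exact ⟨j, (mk_eq_mk.1 hj).symm⟩
    · rintro h1 _ ⟨_, ⟨i, rfl⟩, rfl⟩
      obtain ⟨j, hj⟩ := h1 i
      exact ⟨j, mk_eq_mk.2 hj.symm⟩
    · obtain ⟨_, ⟨i, rfl⟩, hi⟩ := h1 ⟨j, rfl⟩
      exact ⟨i, mk_eq_mk.1 hi⟩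
    · rintro h1 _ ⟨j, rfl⟩
      obtain ⟨i, hi⟩ := h1 j
      exact ⟨_, ⟨i, rfl⟩, mk_eq_mk.2 hi⟩
  simp only [Raw.WF, h, implies_true, true_and, FinitelySupported, supports_iff, key]

/-- The conjunction of a finitely supported set of fewer than `κ` formulas. -/
noncomputable def conj (S : Set (Formula T κ))
    (hc : Cardinal.mk S < Cardinal.lift.{max u₂ u₃} κ) (hf : FinitelySupported srt S) :
    Formula T κ :=
  mk (.conj (exists_index S hc).choose (exists_index S hc).choose_spec.choose
      (exists_index S hc).choose_spec.choose_spec.choose)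
    ((wf_conj (exists_index S hc).choose_spec.choose_spec.choose_spec.choose).2
      ((exists_index S hc).choose_spec.choose_spec.choose_spec.choose_spec.symm ▸ hf))

/-- Negation. -/
def neg : Formula T κ → Formula T κ :=
  Quotient.map (fun R => ⟨.neg R.1, R.2.neg⟩) fun _ _ h => .neg h

/-- A state predicate as a formula. -/
def pred (φ : Pred) : Formula T κ := mk (.pred φ) (.pred φ)

/-- The formula `⟨α⟩A`, in which the names `bn α` are bound in `α` and `A`. -/
def dia (α : Act) : Formula T κ → Formula T κ :=
  Quotient.map (fun R => ⟨.act α R.1, R.2.act α⟩) fun R S h => by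
    obtain ⟨N, hN⟩ := R.2.refl_and_support.2
    obtain ⟨M, hM⟩ := NominalSet.finitelySupported (srt := srt) α
    exact .act (M ∪ N) 1 (hM.mono (by simp)) (fun σ hσ => hN σ fun a ha => hσ a (by
      simp [Finset.mem_coe.1 ha])) (fun _ _ => one_smul _ _) (one_smul _ _)
      ((one_smul (FinPerm srt) R.1).symm ▸ h)

theorem conj_spec (S : Set (Formula T κ)) (hc) (hf) :
    ∃ (I : Set κ.out) (hI : Cardinal.mk I < κ) (f : I → Raw Pred Act κ) (h : ∀ i, (f i).WF T)
      (hw : (Raw.conj I hI f).WF T),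
      Set.range (fun i => mk (f i) (h i)) = S ∧ conj S hc hf = mk (.conj I hI f) hw :=
  ⟨_, _, _, _, _, (exists_index S hc).choose_spec.choose_spec.choose_spec.choose_spec, rfl⟩

theorem neg_mk (R : Raw Pred Act κ) (h : R.WF T) : neg (mk R h) = mk (.neg R) h.neg := rfl

theorem dia_mk (α : Act) (R : Raw Pred Act κ) (h : R.WF T) :
    dia α (mk R h) = mk (.act α R) (h.act α) := rfl

theorem mk_conj_eq_mk_conj {I J : Set κ.out} {hI hJ} {f : I → Raw Pred Act κ}
    {g : J → Raw Pred Act κ} {hw : (Raw.conj I hI f).WF T} {hw' : (Raw.conj J hJ g).WF T}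
    (h : ∀ i, (f i).WF T) (h' : ∀ j, (g j).WF T) :
    mk _ hw = mk _ hw' ↔
      Set.range (fun i => mk (f i) (h i)) = Set.range fun j => mk (g j) (h' j) := by
  rw [mk_eq_mk]
  constructor
  · intro hh
    cases hh with
    | conj u v hu hv =>
      apply Set.Subset.antisymm
      · rintro _ ⟨i, rfl⟩
        exact ⟨u i, mk_eq_mk.2 (hu i).symm⟩
      · rintro _ ⟨j, rfl⟩
        exact ⟨v j, mk_eq_mk.2 (hv j)⟩
  · intro hh
    have h1 : ∀ i, ∃ j, Raw.Alpha T (f i) (g j) := fun i => by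
      obtain ⟨j, hj⟩ := hh.subset ⟨i, rfl⟩
      exact ⟨j, (mk_eq_mk.1 hj).symm⟩
    have h2 : ∀ j, ∃ i, Raw.Alpha T (f i) (g j) := fun j => by
      obtain ⟨i, hi⟩ := hh.superset ⟨j, rfl⟩
      exact ⟨i, mk_eq_mk.1 hi⟩
    choose u hu using h1
    choose v hv using h2
    exact .conj u v hu hv

theorem mk_conj {I : Set κ.out} {hI} {f : I → Raw Pred Act κ} (hw : (Raw.conj I hI f).WF T)
    (h : ∀ i, (f i).WF T) :
    ∃ hc hf, mk _ hw = conj (Set.range fun i => mk (f i) (h i)) hc hf := by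
  have hc : Cardinal.mk (Set.range fun i => mk (f i) (h i)) <
      Cardinal.lift.{max u₂ u₃} κ := by
    have h1 := Cardinal.mk_range_le_lift (f := fun i => mk (T := T) (f i) (h i))
    rw [Cardinal.lift_id'.{w, max u₂ u₃ w}, Cardinal.lift_umax.{w, max u₂ u₃}] at h1
    exact h1.trans_lt (Cardinal.lift_lt.2 hI)
  refine ⟨hc, (wf_conj h).1 hw, ?_⟩
  obtain ⟨J, hJ, g, h', hw', h1, h2⟩ := conj_spec _ hc ((wf_conj h).1 hw)
  rw [h2, mk_conj_eq_mk_conj h h', h1]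

theorem conj_inj {S S' : Set (Formula T κ)} {hc hf hc' hf'} :
    conj S hc hf = conj S' hc' hf' ↔ S = S' := by
  obtain ⟨I, hI, f, h, hw, h1, h2⟩ := conj_spec S hc hf
  obtain ⟨J, hJ, g, h', hw', h1', h2'⟩ := conj_spec S' hc' hf'
  rw [h2, h2', mk_conj_eq_mk_conj h h', h1, h1']

theorem neg_inj {A B : Formula T κ} : neg A = neg B ↔ A = B := by
  obtain ⟨R, h, rfl⟩ := exists_mk A
  obtain ⟨S, h', rfl⟩ := exists_mk B
  rw [neg_mk, neg_mk, mk_eq_mk, mk_eq_mk]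
  exact ⟨fun h => by cases h; assumption, .neg⟩

theorem pred_inj {φ ψ : Pred} : (pred φ : Formula T κ) = pred ψ ↔ φ = ψ := by
  unfold pred
  rw [mk_eq_mk]
  exact ⟨fun h => by cases h; rfl, fun h => h ▸ .pred _⟩

/-- `⟨α⟩A = ⟨β⟩B` if and only if `⟨bn α⟩(α, A) = ⟨bn β⟩(β, B)` as name abstractions. -/
theorem dia_eq_dia {α β : Act} {A B : Formula T κ} :
    dia α A = dia β B ↔ Abs.mk srt (T.bn α) (α, A) = Abs.mk srt (T.bn β) (β, B) := by
  have h0 : Abs.mk srt (T.bn α) (α, A) = Abs.mk srt (T.bn β) (β, B) ↔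
      ∃ π : FinPerm srt, π • (T.bn α, α, A) = (T.bn β, β, B) ∧
        ∀ a ∈ supp srt (α, A) \ (T.bn α : Set 𝒩), π • a = a :=
    Quotient.eq (r := absSetoid srt (Act × Formula T κ))
  have hpair : ∀ N : Set 𝒩, MulAction.Supports (FinPerm srt) N (α, A) ↔
      MulAction.Supports (FinPerm srt) N α ∧ MulAction.Supports (FinPerm srt) N A :=
    fun N => ⟨fun h => ⟨fun σ hσ => congrArg Prod.fst (h σ hσ),
      fun σ hσ => congrArg Prod.snd (h σ hσ)⟩,
      fun h σ hσ => Prod.ext (h.1 σ hσ) (h.2 σ hσ)⟩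
  rw [h0]
  obtain ⟨R, hR, rfl⟩ := exists_mk A
  obtain ⟨S, hS, rfl⟩ := exists_mk B
  rw [dia_mk, dia_mk, mk_eq_mk]
  constructor
  · intro h
    cases h with
    | act N π h1 h2 h3 h4 h5 =>
      refine ⟨π, ?_, fun a ha => h3 a ⟨ha.1 N ((hpair _).2 ⟨h1, ?_⟩), ha.2⟩⟩
      · rw [← h4, T.bn_equivariant]
        exact Prod.ext rfl (Prod.ext rfl (mk_eq_mk.2 h5))
      · exact fun σ hσ => mk_eq_mk.2 (h2 σ fun a ha => hσ ha)
  · rintro ⟨π, h1, h2⟩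
    obtain ⟨M, hM⟩ := NominalSet.finitelySupported (srt := srt) α
    obtain ⟨N, hN⟩ := NominalSet.finitelySupported (srt := srt) (mk R hR)
    obtain ⟨hfin, hsupp⟩ := supports_supp (srt := srt) (x := (α, mk R hR))
      ⟨M ∪ N, (hpair _).2 ⟨hM.mono (by simp), hN.mono (by simp)⟩⟩
    rw [← hfin.coe_toFinset] at h2 hsupp
    refine .act hfin.toFinset π ((hpair _).1 hsupp).1 (fun σ hσ => ?_) h2 ?_ ?_
    · exact mk_eq_mk.1 (((hpair _).1 hsupp).2 σ fun a ha => hσ a ha)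
    · exact congrArg (fun p => p.2.1) h1
    · exact mk_eq_mk.1 (congrArg (fun p => p.2.2) h1)

/-- Every formula is a conjunction, a negation, a state predicate or a modal formula. -/
theorem exists_form (A : Formula T κ) :
    (∃ S hc hf, A = conj S hc hf) ∨ (∃ B, A = neg B) ∨ (∃ φ, A = pred φ) ∨
      ∃ α B, A = dia α B := by
  obtain ⟨R, h, rfl⟩ := exists_mk A
  cases R with
  | conj I hI f =>
    obtain ⟨hc, hf, h1⟩ := mk_conj h (by simp only [Raw.WF] at h; exact h.1)
    exact .inl ⟨_, hc, hf, h1⟩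
  | neg R => exact .inr (.inl ⟨mk R h, rfl⟩)
  | pred φ => exact .inr (.inr (.inl ⟨φ, rfl⟩))
  | act α R => exact .inr (.inr (.inr ⟨α, mk R h, rfl⟩))

theorem conj_ne_neg {S : Set (Formula T κ)} {hc hf B} : conj S hc hf ≠ neg B := by
  obtain ⟨I, hI, f, h, hw, h1, h2⟩ := conj_spec S hc hf
  obtain ⟨R, hR, rfl⟩ := exists_mk B
  rw [h2, neg_mk, Ne, mk_eq_mk]
  rintro ⟨⟩

theorem conj_ne_pred {S : Set (Formula T κ)} {hc hf φ} : conj S hc hf ≠ pred φ := by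
  obtain ⟨I, hI, f, h, hw, h1, h2⟩ := conj_spec S hc hf
  rw [h2, pred, Ne, mk_eq_mk]
  rintro ⟨⟩

theorem conj_ne_dia {S : Set (Formula T κ)} {hc hf α B} : conj S hc hf ≠ dia α B := by
  obtain ⟨I, hI, f, h, hw, h1, h2⟩ := conj_spec S hc hf
  obtain ⟨R, hR, rfl⟩ := exists_mk B
  rw [h2, dia_mk, Ne, mk_eq_mk]
  rintro ⟨⟩

theorem neg_ne_pred {A : Formula T κ} {φ} : neg A ≠ pred φ := by
  obtain ⟨R, hR, rfl⟩ := exists_mk A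
  rw [neg_mk, pred, Ne, mk_eq_mk]
  rintro ⟨⟩

theorem neg_ne_dia {A B : Formula T κ} {α} : neg A ≠ dia α B := by
  obtain ⟨R, hR, rfl⟩ := exists_mk A
  obtain ⟨S, hS, rfl⟩ := exists_mk B
  rw [neg_mk, dia_mk, Ne, mk_eq_mk]
  rintro ⟨⟩

theorem pred_ne_dia {B : Formula T κ} {φ α} : pred φ ≠ dia α B := by
  obtain ⟨S, hS, rfl⟩ := exists_mk B
  rw [dia_mk, pred, Ne, mk_eq_mk]
  rintro ⟨⟩

/-- `ImmSub B A`: the formula `B` is an immediate subformula of `A`.  (A formula `⟨α⟩B` has an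
immediate subformula for each of its representations.) -/
inductive ImmSub : Formula T κ → Formula T κ → Prop
  | conj (S : Set (Formula T κ)) (hc hf) (B : Formula T κ) (hB : B ∈ S) :
      ImmSub B (conj S hc hf)
  | neg (B : Formula T κ) : ImmSub B (neg B)
  | dia (α : Act) (B : Formula T κ) : ImmSub B (dia α B)

theorem immSub_wf : WellFounded (ImmSub (T := T) (κ := κ)) := by
  have key : ∀ (R : Raw Pred Act κ) (π : FinPerm srt) (h : (π • R).WF T),
      Acc ImmSub (mk (π • R) h) := by
    intro R
    induction R with
    | conj I hI f ih =>
      intro π h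
      have hf' : ∀ i, (π • f i).WF T := by
        have h' := h
        rw [Raw.smul_conj] at h'
        simp only [Raw.WF] at h'
        exact h'.1
      obtain ⟨hc, hf, h1⟩ := mk_conj h hf'
      refine ⟨_, fun B hB => ?_⟩
      generalize hA : mk (π • Raw.conj I hI f) h = A at hB
      change mk (π • Raw.conj I hI f) h = _ at h1
      rw [hA] at h1
      cases hB with
      | conj S hc' hf'' _ hBS =>
        rw [conj_inj] at h1
        rw [h1] at hBS
        obtain ⟨i, rfl⟩ := hBS
        exact ih i π (hf' i)
      | neg => exact absurd h1.symm conj_ne_neg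
      | dia => exact absurd h1.symm conj_ne_dia
    | neg R ih =>
      intro π h
      refine ⟨_, fun B hB => ?_⟩
      generalize hA : mk (π • Raw.neg R) h = A at hB
      have h0 : (π • R).WF T := h
      have hA' : neg (mk (π • R) h0) = A := hA
      cases hB with
      | conj => exact absurd hA'.symm conj_ne_neg
      | neg => rw [neg_inj] at hA'; exact hA' ▸ ih π h0
      | dia => exact absurd hA' neg_ne_dia
    | pred φ =>
      intro π h
      refine ⟨_, fun B hB => ?_⟩
      generalize hA : mk (π • Raw.pred φ) h = A at hB
      have hA' : pred (π • φ) = A := hA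
      cases hB with
      | conj => exact absurd hA'.symm conj_ne_pred
      | neg => exact absurd hA'.symm neg_ne_pred
      | dia => exact absurd hA' pred_ne_dia
    | act α R ih =>
      intro π h
      refine ⟨_, fun B hB => ?_⟩
      generalize hA : mk (π • Raw.act α R) h = A at hB
      have h0 : (π • R).WF T := h
      have hA' : dia (π • α) (mk (π • R) h0) = A := hA
      cases hB with
      | conj => exact absurd hA'.symm conj_ne_dia
      | neg => exact absurd hA'.symm neg_ne_dia
      | dia β B =>
        obtain ⟨S, hS, rfl⟩ := exists_mk B
        rw [dia_mk, dia_mk, mk_eq_mk] at hA'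
        cases hA' with
        | act N σ _ _ _ _ h5 =>
          rw [smul_smul] at h5
          have hw : ((σ * π) • R).WF T := by rw [mul_smul]; exact h0.smul σ
          have : mk S hS = mk ((σ * π) • R) hw := mk_eq_mk.2 h5.symm
          rw [this]
          exact ih _ hw
  refine ⟨fun A => ?_⟩
  obtain ⟨R, h, rfl⟩ := exists_mk A
  have := key R 1
  rw [one_smul] at this
  exact this h

end Formula

/-! ### Validity and logical equivalence -/

/-- `T.Valid A P`: the formula `A` is valid for the state `P`.  This is recursion over `A`; the
four cases are stated as `NTS.valid_conj`, `NTS.valid_neg`, `NTS.valid_pred` and `NTS.valid_dia`. -/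
noncomputable def NTS.Valid (T : NTS srt State Pred Act) : Formula T κ → State → Prop :=
  Formula.immSub_wf.fix fun A V P =>
    (∃ S hc hf, ∃ hA : A = Formula.conj S hc hf,
      ∀ B, ∀ hB : B ∈ S, V B (hA ▸ .conj S hc hf B hB) P) ∨
    (∃ B, ∃ hA : A = Formula.neg B, ¬ V B (hA ▸ .neg B) P) ∨
    (∃ φ, A = Formula.pred φ ∧ T.entails P φ) ∨
    (∃ α B, ∃ hA : A = Formula.dia α B, FreshFor srt (T.bn α) P ∧
      ∃ P', T.Step P α P' ∧ V B (hA ▸ .dia α B) P')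

theorem NTS.valid_iff (T : NTS srt State Pred Act) (A : Formula T κ) (P : State) :
    T.Valid A P ↔
      (∃ S hc hf, A = Formula.conj S hc hf ∧ ∀ B ∈ S, T.Valid B P) ∨
      (∃ B, A = Formula.neg B ∧ ¬ T.Valid B P) ∨
      (∃ φ, A = Formula.pred φ ∧ T.entails P φ) ∨
      (∃ α B, A = Formula.dia α B ∧ FreshFor srt (T.bn α) P ∧
        ∃ P', T.Step P α P' ∧ T.Valid B P') := by
  unfold NTS.Valid
  rw [WellFounded.fix_eq]
  simp only [exists_prop]

theorem NTS.valid_conj (T : NTS srt State Pred Act) (S : Set (Formula T κ)) (hc hf) (P : State) :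
    T.Valid (Formula.conj S hc hf) P ↔ ∀ A ∈ S, T.Valid A P := by
  rw [T.valid_iff]
  simp only [Formula.conj_inj, Formula.conj_ne_neg, Formula.conj_ne_pred, Formula.conj_ne_dia,
    false_and, exists_false, or_false]
  exact ⟨fun ⟨S', _, _, h, h'⟩ => h ▸ h', fun h => ⟨S, hc, hf, rfl, h⟩⟩

theorem NTS.valid_neg (T : NTS srt State Pred Act) (A : Formula T κ) (P : State) :
    T.Valid (Formula.neg A) P ↔ ¬ T.Valid A P := by
  rw [T.valid_iff]
  simp [Formula.neg_inj, Formula.conj_ne_neg.symm, Formula.neg_ne_pred, Formula.neg_ne_dia]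

theorem NTS.valid_pred (T : NTS srt State Pred Act) (φ : Pred) (P : State) :
    T.Valid (Formula.pred φ : Formula T κ) P ↔ T.entails P φ := by
  rw [T.valid_iff]
  simp [Formula.pred_inj, Formula.conj_ne_pred.symm, Formula.neg_ne_pred.symm,
    Formula.pred_ne_dia]

theorem NTS.valid_dia (T : NTS srt State Pred Act) (α : Act) (A : Formula T κ) (P : State) :
    T.Valid (Formula.dia α A) P ↔ ∃ α' A', Formula.dia α A = Formula.dia α' A' ∧
      FreshFor srt (T.bn α') P ∧ ∃ P', T.Step P α' P' ∧ T.Valid A' P' := by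
  rw [T.valid_iff]
  simp [Formula.conj_ne_dia.symm, Formula.neg_ne_dia.symm, Formula.pred_ne_dia.symm]

/-- Logical equivalence of states, for the formulas with conjunctions bounded by `κ`. -/
def NTS.LogicallyEquivalent (T : NTS srt State Pred Act) (κ : Cardinal.{w}) (P Q : State) :
    Prop :=
  ∀ A : Formula T κ, T.Valid A P ↔ T.Valid A Q

end Main

end NominalHML

/-! A bisimulation `R` preserves validity of every formula from `P` to `Q` whenever `R P Q`, and
since `R` is symmetric this yields an equivalence. The proof is by well-founded induction on the
formula, for all related pairs at once. Conjunctions follow from the induction hypothesis, negation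
uses it for the swapped pair, and state predicates are covered by static implication.

The modal case carries the difficulty. Validity of `⟨α⟩A` at `P` supplies a representative `⟨β⟩C`
and a step from `P` to `P'` with `bn β` fresh for `P`, whereas the simulation clause asks for
freshness for `Q`. The remedy (`NTS.exists_fresh_dia`) is to rename by a permutation `τ` that sends
`bn β` to names fresh for `Q` and fixes the free names of both `⟨bn β⟩(β, C)` and `⟨bn β⟩(β, P')`.
Neither abstraction changes, so formula and transition stay the same, with new representatives `τ •
C` and `τ • P'`. Equivariance of validity (`NTS.valid_smul_iff`) shows that `τ • C` holds at `τ •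
P'`, and `Q` can now simulate the step. The bisimulation itself need not be equivariant.

The induction hypothesis is needed at the renamed body `τ • C`, not only at `A`. This is why
`ImmSub` counts the bodies of all representations of a modal formula as immediate subformulas. -/

namespace NominalHML

/-! ### Permutations acting on freshness, abstractions and transitions. -/

variable {𝒩 : Type uN} {𝒮 : Type uS} {srt : 𝒩 → 𝒮}

theorem FreshFor.smul {X : Type*} [MulAction (FinPerm srt) X] {N : Finset 𝒩} {x : X}
    (h : FreshFor srt N x) (π : FinPerm srt) : FreshFor srt (π • N) (π • x) := by
  intro a ha hx
  obtain ⟨b, hb, rfl⟩ := Finset.mem_smul_finset.1 ha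
  rw [supp_smul, Set.smul_mem_smul_set_iff] at hx
  exact h b hb hx

/-- The union of two supports supports the pair. It is needed for the bodies `(α, A)` and `(α, P')`
of abstractions, whose supports must be finite before names can be chosen outside them. -/
theorem FinitelySupported.prodMk {X Y : Type*} [MulAction (FinPerm srt) X]
    [MulAction (FinPerm srt) Y] {x : X} {y : Y} (hx : FinitelySupported srt x)
    (hy : FinitelySupported srt y) : FinitelySupported srt (x, y) := by
  obtain ⟨M, hM⟩ := hx
  obtain ⟨N, hN⟩ := hy
  exact ⟨M ∪ N, fun π hπ => Prod.ext (hM π fun a ha => hπ (by simp [Finset.mem_coe.1 ha]))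
    (hN π fun a ha => hπ (by simp [Finset.mem_coe.1 ha]))⟩

/-- An abstraction is unchanged if its body is renamed by a permutation that fixes the free
names. -/
theorem Abs.mk_smul {X : Type*} [MulAction (FinPerm srt) X] (π : FinPerm srt) (N : Finset 𝒩)
    (x : X) (h : Fixes π (supp srt x \ (N : Set 𝒩))) :
    Abs.mk srt (π • N) (π • x) = Abs.mk srt N x :=
  (Quotient.sound (s := absSetoid srt X) ⟨π, rfl, h⟩ :
    Abs.mk srt N x = Abs.mk srt (π • N) (π • x)).symm

variable {State : Type u₁} {Pred : Type u₂} {Act : Type u₃}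
  [NominalSet srt State] [NominalSet srt Pred] [NominalSet srt Act]

/-- A permutation acts on a residual through any representative, so the permuted residual is by
definition the abstraction of the permuted body over `π • bn α`, and this set is `bn (π • α)`. -/
theorem NTS.Step.smul {T : NTS srt State Pred Act} {P P' : State} {α : Act}
    (h : T.Step P α P') (π : FinPerm srt) : T.Step (π • P) (π • α) (π • P') := by
  have := T.trans_equivariant π _ h
  unfold NTS.Step
  rw [T.bn_equivariant]
  exact this

variable [InfiniteSorts srt] {κ : Cardinal.{w}} {T : NTS srt State Pred Act}

/-! ### Permutations acting on the formula constructors. -/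

namespace Formula

/-- The size bound and the finite support of `π • S` are arguments of `conj`, hence the existential
form. On raw representatives the action is conjunct by conjunct, so the set of classes is moved by
`π`. -/
theorem smul_conj (π : FinPerm srt) (S : Set (Formula T κ)) (hc hf) :
    ∃ hc' hf', π • conj S hc hf = conj (π • S) hc' hf' := by
  obtain ⟨I, hI, f, h, hw, rfl, h2⟩ := conj_spec S hc hf
  obtain ⟨hc', hf', h3⟩ := mk_conj (hw.smul π) fun i => (h i).smul π
  have h4 : (π • Set.range fun i => mk (f i) (h i)) =
      Set.range fun i => mk (π • f i) ((h i).smul π) := by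
    ext A
    simp [Set.mem_smul_set, smul_mk]
  refine ⟨h4 ▸ hc', h4 ▸ hf', ?_⟩
  rw [h2, smul_mk]
  refine Eq.trans h3 ?_
  rw [conj_inj]
  exact h4.symm

theorem smul_neg (π : FinPerm srt) (A : Formula T κ) : π • neg A = neg (π • A) := by
  obtain ⟨R, h, rfl⟩ := exists_mk A
  rfl

theorem smul_pred (π : FinPerm srt) (φ : Pred) :
    π • (pred φ : Formula T κ) = pred (π • φ) := rfl

theorem smul_dia (π : FinPerm srt) (α : Act) (A : Formula T κ) :
    π • dia α A = dia (π • α) (π • A) := by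
  obtain ⟨R, h, rfl⟩ := exists_mk A
  rfl

end Formula

/-! ### Equivariance of validity and fresh representatives. -/

/-- Validity is equivariant. -/
theorem NTS.valid_smul_iff (A : Formula T κ) (π : FinPerm srt) (P : State) :
    T.Valid (π • A) (π • P) ↔ T.Valid A P := by
  induction A using Formula.immSub_wf.induction generalizing π P with
  | _ A ih =>
    rcases A.exists_form with ⟨S, hc, hf, rfl⟩ | ⟨B, rfl⟩ | ⟨φ, rfl⟩ | ⟨α, B, rfl⟩
    · obtain ⟨hc', hf', h⟩ := Formula.smul_conj π S hc hf
      rw [h, T.valid_conj, T.valid_conj]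
      constructor
      · exact fun h B hB => (ih B (.conj S hc hf B hB) π P).1 (h _ (Set.smul_mem_smul_set hB))
      · rintro h _ ⟨B, hB, rfl⟩
        exact (ih B (.conj S hc hf B hB) π P).2 (h B hB)
    · rw [Formula.smul_neg, T.valid_neg, T.valid_neg, ih B (.neg B)]
    · rw [Formula.smul_pred, T.valid_pred, T.valid_pred]
      -- Equivariance of entailment is given as an implication only; the converse is its instance at
      -- `π⁻¹`.
      refine ⟨fun h => ?_, T.entails_equivariant π P φ⟩
      simpa using T.entails_equivariant π⁻¹ _ _ h
    · constructor
      · rw [Formula.smul_dia, T.valid_dia, T.valid_dia]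
        rintro ⟨β, C, h, hfr, P', hstep, hP'⟩
        -- The witnesses for the permuted formula are pulled back along `π⁻¹`.
        have h' : Formula.dia α B = Formula.dia (π⁻¹ • β) (π⁻¹ • C) := by
          rw [← Formula.smul_dia, ← h, ← Formula.smul_dia, inv_smul_smul]
        refine ⟨π⁻¹ • β, π⁻¹ • C, h', ?_, π⁻¹ • P', ?_, ?_⟩
        · rw [T.bn_equivariant]
          simpa using hfr.smul π⁻¹
        · simpa using hstep.smul π⁻¹
        · rw [← ih _ (h' ▸ .dia _ _) π]
          simpa using hP'
      · rw [T.valid_dia, Formula.smul_dia, T.valid_dia]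
        rintro ⟨β, C, h, hfr, P', hstep, hP'⟩
        refine ⟨π • β, π • C, ?_, ?_, π • P', hstep.smul π, (ih C (h ▸ .dia _ _) π P').2 hP'⟩
        · rw [← Formula.smul_dia, h, Formula.smul_dia]
        · rw [T.bn_equivariant]
          exact hfr.smul π

/-- The bound names of a modal formula and of a transition witnessing it can be chosen fresh for
any state. -/
theorem NTS.exists_fresh_dia {P P' : State} {α : Act} {A : Formula T κ}
    (hstep : T.Step P α P') (hA : T.Valid A P') (Q : State) :
    ∃ β B P'', Formula.dia α A = Formula.dia β B ∧ FreshFor srt (T.bn β) Q ∧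
      T.Step P β P'' ∧ T.Valid B P'' := by
  have hα := NominalSet.finitelySupported (srt := srt) α
  have h1 := (supports_supp (NominalSet.finitelySupported (srt := srt) Q)).1
  have h2 := (supports_supp
    (hα.prodMk (NominalSet.finitelySupported (srt := srt) A))).1
  have h3 := (supports_supp
    (hα.prodMk (NominalSet.finitelySupported (srt := srt) P'))).1
  -- A single `τ` must serve both abstractions, so that formula and transition receive the same new
  -- action `τ • α`. The support of `Q` is in the union for the sake of `hτ`, the supports of the
  -- two bodies for the sake of `hτ'`.
  obtain ⟨τ, hτ, hτ'⟩ := exists_fresh (srt := srt) (T.bn α)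
    (h1.toFinset ∪ h2.toFinset ∪ h3.toFinset)
  refine ⟨τ • α, τ • A, τ • P', ?_, ?_, ?_, (T.valid_smul_iff A τ P').2 hA⟩
  · rw [Formula.dia_eq_dia, T.bn_equivariant]
    exact (Abs.mk_smul τ _ (α, A) fun a ha => hτ' a (by simp [ha.1]) ha.2).symm
  · intro a ha hQ
    rw [T.bn_equivariant] at ha
    obtain ⟨b, hb, rfl⟩ := Finset.mem_smul_finset.1 ha
    exact hτ b hb (by simp [hQ])
  · unfold NTS.Step
    rw [T.bn_equivariant]
    -- The source must remain `P`, so `NTS.Step.smul`, which would move it to `τ • P`, does not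
    -- apply. Instead the residual is the same abstraction after renaming.
    have := Abs.mk_smul τ (T.bn α) (α, P') fun a ha => hτ' a (by simp [ha.1]) ha.2
    rw [Prod.smul_mk] at this
    rw [this]
    exact hstep

/-! ### Bisimulations and validity. -/

/-- A bisimulation preserves validity. -/
theorem NTS.IsBisimulation.valid {R : State → State → Prop} (hR : T.IsBisimulation R)
    (A : Formula T κ) {P Q : State} (hPQ : R P Q) (h : T.Valid A P) : T.Valid A Q := by
  -- The pair has to vary: negation exchanges the two states, and a modality passes to their
  -- derivatives.
  induction A using Formula.immSub_wf.induction generalizing P Q with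
  | _ A ih =>
    rcases A.exists_form with ⟨S, hc, hf, rfl⟩ | ⟨B, rfl⟩ | ⟨φ, rfl⟩ | ⟨α, B, rfl⟩
    · rw [T.valid_conj] at h ⊢
      exact fun B hB => ih B (.conj S hc hf B hB) hPQ (h B hB)
    · rw [T.valid_neg] at h ⊢
      exact fun hB => h (ih B (.neg B) (hR.symm _ _ hPQ) hB)
    · rw [T.valid_pred] at h ⊢
      exact hR.static_implication _ _ hPQ φ h
    · rw [T.valid_dia] at h ⊢
      -- Freshness of `bn β` for `P` is dropped, since the simulation clause requires freshness for
      -- `Q`, which the next representative `⟨γ⟩D` provides.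
      obtain ⟨β, C, hC, -, P', hstep, hP'⟩ := h
      obtain ⟨γ, D, P'', hD, hfr, hstep', hP''⟩ := T.exists_fresh_dia hstep hP' Q
      obtain ⟨Q', hQ', hR'⟩ := hR.simulation _ _ hPQ γ P'' hfr hstep'
      have hBD := hC.trans hD
      -- By `hBD`, the renamed body `D` is an immediate subformula of the original modal formula, so
      -- the induction hypothesis transfers it from `P''` to `Q'`.
      exact ⟨γ, D, hBD, hfr, Q', hQ', ih D (hBD ▸ .dia γ D) hR' hP''⟩

end NominalHML

theorem mainTheorem2
    {𝒩 : Type uN} {𝒮 : Type uS} [Countable 𝒩] [Infinite 𝒩]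
    (srt : 𝒩 → 𝒮) [NominalHML.InfiniteSorts srt]
    {State : Type u₁} {Pred : Type u₂} {Act : Type u₃}
    [NominalHML.NominalSet srt State] [NominalHML.NominalSet srt Pred]
    [NominalHML.NominalSet srt Act]
    (T : NominalHML.NTS srt State Pred Act)
    (κ : Cardinal.{w}) (hκ : Cardinal.aleph0 < κ)
    (hκState : Cardinal.lift.{w} (Cardinal.mk State) < Cardinal.lift.{u₁} κ)
    (P Q : State) (h : T.Bisimilar P Q) :
    T.LogicallyEquivalent κ P Q := by
  obtain ⟨R, hR, hPQ⟩ := h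
  exact fun A => ⟨hR.valid A hPQ, hR.valid A (hR.symm _ _ hPQ)⟩
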